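/- Fix the following parameters: a cell radius $R>0$, an altitude $h\ge 0$, a transmit power $P>0$, path loss exponents $\alpha_L,\alpha_N\in\mathbb R$, Nakagami parameters $m_L,m_N>0$, durations $t_{DC},T_s>0$, and environment parameters $a\ge 0$, $b\in\mathbb R$. Put $p_L(r)=p_{\mathrm{LOS}}(r)=\bigl(1+a\exp(-b(\tfrac{180}{\pi}\arctan|h/r|-a))\bigr)^{-1}$ and $p_N(r)=1-p_{\mathrm{LOS}}(r)$. Let $G_{dM},G_{dm},G_{uM},G_{um}\ge 0$ be the main and side lobe antenna gains of devices and UAVs, let $\theta_d,\theta_u\in[0,2\pi]$ be the main lobe beamwidths, and put $c_d=\theta_d/2\pi$, $c_u=\theta_u/2\pi$, $(G_1,\dots,G_4)=(G_{dM}G_{uM},G_{dM}G_{um},G_{dm}G_{uM},G_{dm}G_{um})$ and $(\mathbb P_1,\dots,\mathbb P_4)=(c_dc_u,\ c_d(1-c_u),\ (1-c_d)c_u,\ (1-c_d)(1-c_u))$. For $\lambda,\rho>0$, let the interferers $\Phi=\{x_i\}$ of a typical UAV above the origin be a Poisson point process in $\mathbb R^2$ of intensity $\lambda$ outside the disc of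 radius $\rho$ around the origin, and with no points in that disc. Let each interferer be either line-of-sight (LOS, $k=L$) or non-line-of-sight (NLOS, $k=N$), in such a way that the interferers of state $k$ form a Poisson point process $\Phi_k$ of intensity $\lambda\, p_k(\|x\|)$ outside that disc. Let the fading gains $H_{k,i}$ (Gamma distributed with shape $m_k$ and mean $1$) and the antenna gains $G_{(i)}$ (equal to $G_\epsilon$ with probability $\mathbb P_\epsilon$) be mutually independent, and independent of the positions and states of the interferers. Let $$I_k=\sum_{i:\,x_i\in\Phi_k}P\,H_{k,i}\,G_{(i)}\,(\|x_i\|^2+h^2)^{-\alpha_k/2}\in[0,\infty],\qquad k\in\{L,N\}.$$ Then for $k\in\{L,N\}$ and all $s\ge0$, $$\mathbb E\bigl[e^{-sI_k}\bigr]=\exp\Bigl\{-2\pi\lambda\sum_{\epsilon=1}^4\mathbb P_\epsilon\int_{\rho}^\infty p_k(r)\Bigl(1-\bigl(1+\tfrac{sPG_\epsilon (r^2+h^2)^{-\alpha_k/2}}{m_k}\bigr)^{-m_k}\Bigr)r\,dr\Bigr\}$$ in each of the following two cases: (1) URDC-UL: $\lambda=\lambda_{DC}=\frac{t_{DC}}{T_s}\cdot\frac{2}{3\sqrt3R^2}$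 and $\rho=R/2$; (2) SUC-UL: $\lambda=\lambda_{UC}=\frac{2}{3\sqrt3R^2}$ and $\rho=R$. Here $e^{-\infty}=0$ and $0\cdot\infty=0$. If $\alpha_k>2$, then moreover $I_k<\infty$ almost surely and all the integrals converge. -/

import Mathlib

open MeasureTheory ProbabilityTheory
open scoped ENNReal NNReal

noncomputable section

namespace UAVUplink

/-- The plane in which the devices lie; the typical UAV hovers above the origin. -/
abbrev Plane : Type := EuclideanSpace ℝ (Fin 2)

/-- The state of a device-to-UAV link: line of sight or non line of sight. -/
inductive Link : Type
  | los
  | nlos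
  deriving DecidableEq

instance : MeasurableSpace Link := ⊤

/-- A Poisson point process with intensity measure `μ`, given through its random counting measure
`N`: the number of points in a measurable set of finite intensity is Poisson distributed with mean
the intensity of the set, and the numbers of points in disjoint measurable sets are independent. -/
structure IsPoissonProcess {Ω E : Type*} [MeasurableSpace Ω] [MeasurableSpace E]
    (Pr : Measure Ω) (N : Ω → Measure E) (μ : Measure E) : Prop where
  hasLaw_count : ∀ A : Set E, MeasurableSet A → μ A ≠ ∞ →
    HasLaw (fun ω => N ω A)
      ((poissonMeasure (μ A).toNNReal).map (fun n : ℕ => (n : ℝ≥0∞))) Pr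
  indep_count : ∀ (n : ℕ) (A : Fin n → Set E), (∀ j, MeasurableSet (A j)) →
    Pairwise (fun i j => Disjoint (A i) (A j)) →
    iIndepFun (fun j ω => N ω (A j)) Pr

/-- The parameters of the network. -/
structure Params where
  /-- radius of the hexagonal cells -/
  R : ℝ
  /-- altitude of the UAVs -/
  h : ℝ
  /-- first environment parameter of the line-of-sight probability -/
  a : ℝ
  /-- second environment parameter of the line-of-sight probability -/
  b : ℝ
  /-- transmit power of the devices -/
  P : ℝ
  /-- path loss exponents -/
  α : Link → ℝ
  /-- Nakagami parameters, the shapes of the power fading gains -/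
  m : Link → ℝ
  /-- main lobe gain of the device antennas -/
  GdM : ℝ
  /-- side lobe gain of the device antennas -/
  Gdm : ℝ
  /-- main lobe gain of the UAV antennas -/
  GuM : ℝ
  /-- side lobe gain of the UAV antennas -/
  Gum : ℝ
  /-- main lobe beamwidth of the device antennas -/
  θd : ℝ
  /-- main lobe beamwidth of the UAV antennas -/
  θu : ℝ
  /-- transmission time of a device within a slot, in the device-centric scheme -/
  tDC : ℝ
  /-- duration of a time slot -/
  Ts : ℝ
  R_pos : 0 < R
  h_nonneg : 0 ≤ h
  a_nonneg : 0 ≤ a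
  P_pos : 0 < P
  m_pos : ∀ k, 0 < m k
  GdM_nonneg : 0 ≤ GdM
  Gdm_nonneg : 0 ≤ Gdm
  GuM_nonneg : 0 ≤ GuM
  Gum_nonneg : 0 ≤ Gum
  θd_mem : θd ∈ Set.Icc 0 (2 * Real.pi)
  θu_mem : θu ∈ Set.Icc 0 (2 * Real.pi)
  tDC_pos : 0 < tDC
  Ts_pos : 0 < Ts

namespace Params

variable (p : Params)

/-- The probability that a link of ground distance `r` is in line of sight. -/
def pLOS (r : ℝ) : ℝ :=
  1 / (1 + p.a * Real.exp (-p.b * (180 / Real.pi * Real.arctan |p.h / r| - p.a)))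

/-- The probability that a link of ground distance `r` has a given state. -/
def linkProb (k : Link) (r : ℝ) : ℝ :=
  match k with
  | .los => p.pLOS r
  | .nlos => 1 - p.pLOS r

/-- Intensity of the interferers in the device-centric scheme. -/
def lambdaDC : ℝ := p.tDC / p.Ts * (2 / (3 * √3 * p.R ^ 2))

/-- Intensity of the interferers in the UAV-centric scheme. -/
def lambdaUC : ℝ := 2 / (3 * √3 * p.R ^ 2)

/-- The four values of the sectored antenna gain between an interferer and the typical UAV. -/
def gain : Fin 4 → ℝ :=
  ![p.GdM * p.GuM, p.GdM * p.Gum, p.Gdm * p.GuM, p.Gdm * p.Gum]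

/-- The probability that a randomly oriented device points its main lobe to the typical UAV. -/
def cd : ℝ := p.θd / (2 * Real.pi)

/-- The probability that the main lobe of the typical UAV covers an interferer. -/
def cu : ℝ := p.θu / (2 * Real.pi)

/-- The probabilities of the four antenna gain values. -/
def gainProb : Fin 4 → ℝ :=
  ![p.cd * p.cu, p.cd * (1 - p.cu), (1 - p.cd) * p.cu, (1 - p.cd) * (1 - p.cu)]

/-- The law of the random antenna gain. -/
def gainLaw : Measure ℝ := ∑ ε : Fin 4, ENNReal.ofReal (p.gainProb ε) • Measure.dirac (p.gain ε)

/-- The measure on the plane with density `x ↦ lam * q ‖x‖` outside the disc of radius `ρ` around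
the origin, and no mass in that disc. -/
def intensity (lam ρ : ℝ) (q : ℝ → ℝ) : Measure Plane :=
  (volume.restrict (Metric.closedBall (0 : Plane) ρ)ᶜ).withDensity
    (fun x => ENNReal.ofReal (lam * q ‖x‖))

/-- The received power, up to fading and antenna gains, at ground distance `r`. -/
def pathPower (k : Link) (r : ℝ) : ℝ := p.P * (r ^ 2 + p.h ^ 2) ^ (-p.α k / 2)

end Params

/-- The interferers of the typical UAV: random points `x i` of the plane, each with the state of
its link to the typical UAV, its fading gains `H k i` (`H k i` is used when the link is in state
`k`) and its antenna gain `G i`. Here `lam` is the intensity of the interferers and `ρ` is the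
radius of the interference-free disc. -/
structure IsInterfererField (p : Params) (lam ρ : ℝ) {Ω : Type*} [MeasurableSpace Ω]
    (Pr : Measure Ω) (x : ℕ → Ω → Plane) (state : ℕ → Ω → Link)
    (H : Link → ℕ → Ω → ℝ) (G : ℕ → Ω → ℝ) : Prop where
  measurable_x : ∀ i, Measurable (x i)
  measurable_state : ∀ i, Measurable (state i)
  /-- All interferers form a Poisson point process of constant intensity outside the disc. -/
  poisson : IsPoissonProcess Pr
    (fun ω => Measure.sum (fun i => Measure.dirac (x i ω)))
    (Params.intensity lam ρ (fun _ => 1))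
  /-- The interferers whose link is in state `k` form a Poisson point process, whose intensity is
  that of all interferers times the probability of the state `k`. -/
  poisson_link : ∀ k, IsPoissonProcess Pr
    (fun ω => Measure.sum (fun i => if state i ω = k then Measure.dirac (x i ω) else 0))
    (Params.intensity lam ρ (p.linkProb k))
  /-- The fading gains are Gamma variables of shape `m k` and mean one. -/
  hasLaw_fading : ∀ k i, HasLaw (H k i) (gammaMeasure (p.m k) (p.m k)) Pr
  hasLaw_gain : ∀ i, HasLaw (G i) p.gainLaw Pr
  /-- All fading gains and antenna gains are mutually independent. -/
  indep_marks : iIndepFun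
    (Sum.elim (fun j : Link × ℕ => H j.1 j.2) G : (Link × ℕ) ⊕ ℕ → Ω → ℝ) Pr
  /-- The gains are independent of the positions and link states. -/
  indep_positions : IndepFun (fun ω i => (x i ω, state i ω))
    (fun ω (j : (Link × ℕ) ⊕ ℕ) => Sum.elim (fun j : Link × ℕ => H j.1 j.2 ω) (fun i => G i ω) j) Pr

/-- The aggregate interference of the links in state `k`, a series of nonnegative terms. -/
def interference (p : Params) (k : Link) {Ω : Type*} (x : ℕ → Ω → Plane) (state : ℕ → Ω → Link)
    (H : Link → ℕ → Ω → ℝ) (G : ℕ → Ω → ℝ) (ω : Ω) : ℝ≥0∞ :=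
  ∑' i, if state i ω = k then ENNReal.ofReal (H k i ω * G i ω * p.pathPower k ‖x i ω‖) else 0

/-- The Laplace transform `E[exp(-s I)]` at `s ≥ 0` of a random variable with values in `[0, ∞]`,
with `exp(-∞) = 0`. -/
def laplaceTransform {Ω : Type*} [MeasurableSpace Ω] (Pr : Measure Ω) (I : Ω → ℝ≥0∞) (s : ℝ) :
    ℝ≥0∞ :=
  ∫⁻ ω, EReal.exp (-((ENNReal.ofReal s * I ω : ℝ≥0∞) : EReal)) ∂Pr

/-- The integrand `q_k(r) (1 - (1 + s P G_ε (r² + h²)^(-α_k / 2) / m_k)^(-m_k)) r`, where `q_k(r)`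
is the probability of the link state `k` at distance `r`. -/
def kernel (p : Params) (k : Link) (s : ℝ) (ε : Fin 4) (r : ℝ) : ℝ :=
  p.linkProb k r *
    (1 - (1 + s * p.P * p.gain ε * (r ^ 2 + p.h ^ 2) ^ (-p.α k / 2) / p.m k) ^ (-p.m k)) * r

/-- The Laplace transform at `s` of the interference of the links in state `k` has the explicit
form `exp (-2 π lam ∑_ε P_ε ∫_ρ^∞ kernel)`. The first part is an identity in `[0, ∞]`, in which the
interference and the integrals may be infinite and `exp(-∞) = 0`; the second part says that for a
path loss exponent above two everything is finite, and gives the identity in the reals. -/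
def HasLaplaceForm (p : Params) (lam ρ : ℝ) (k : Link) {Ω : Type*} [MeasurableSpace Ω]
    (Pr : Measure Ω) (I : Ω → ℝ≥0∞) (s : ℝ) : Prop :=
  laplaceTransform Pr I s =
      EReal.exp (-((ENNReal.ofReal (2 * Real.pi * lam) *
        ∑ ε : Fin 4, ENNReal.ofReal (p.gainProb ε) *
          ∫⁻ r in Set.Ioi ρ, ENNReal.ofReal (kernel p k s ε r) : ℝ≥0∞) : EReal)) ∧
  (2 < p.α k →
    (∀ᵐ ω ∂Pr, I ω < ∞) ∧
    (∀ ε : Fin 4, IntegrableOn (kernel p k s ε) (Set.Ioi ρ)) ∧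
    ∫ ω, Real.exp (-s * (I ω).toReal) ∂Pr =
      Real.exp (-2 * Real.pi * lam *
        ∑ ε : Fin 4, p.gainProb ε * ∫ r in Set.Ioi ρ, kernel p k s ε r))

end UAVUplink

end

/-! Given positions and states, the gains of different interferers are independent, so averaging
e^{-s I_k} over the gains leaves the product, over the points of Φ_k, of the one-point transform
L(r) = ∑_ε P_ε (1 + s G_ε g(r) / m_k)^{-m_k}, with g = `pathPower` (`lintegral_prod_marks`,
`lintegral_expNeg_marks`). With f = -log L this product is e^{-∑ f}, a functional of Φ_k alone, and
the Laplace functional of a Poisson process (`IsPoissonProcess.lintegral_expNeg_lintegral`)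
evaluates its mean as exp(-∫ (1 - L) dμ). Since 1 - L is the P_ε-average of the single-gain terms,
polar coordinates give the stated exponent (`lintegral_intensity_powerTransform`).

All of this takes place in [0, ∞] with `expNeg`, so infinite interference and divergent integrals
need no separate treatment. Infinitely many points are reached from the first n by dominated
convergence, as `expNeg` is at most one.

For α_k > 2, the bound 1 - (1 + t/m)^{-m} ≤ t makes the exponent at most s K with K finite and
independent of s. Letting s → 0 shows that I_k is almost surely finite
(`ae_lt_top_of_laplaceTransform_ge`), and the identity passes to the reals. -/

noncomputable section

namespace UAVUplink

open Filter Topology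

/-! ### The decreasing exponential on [0, ∞] -/

/-- The function `a ↦ exp (-a)` on `[0, ∞]`, with `exp (-∞) = 0`. -/
def expNeg (a : ℝ≥0∞) : ℝ≥0∞ := EReal.exp (-(a : EReal))

lemma expNeg_zero : expNeg 0 = 1 := by simp [expNeg]

lemma expNeg_top : expNeg ∞ = 0 := by simp [expNeg]

/-- Infinite arguments cause no trouble: the exponential of an element of [0, ∞] is never zero, so
inverting the product meets no 0 · ∞. -/
lemma expNeg_add (a b : ℝ≥0∞) : expNeg (a + b) = expNeg a * expNeg b := by
  rw [expNeg, EReal.coe_ennreal_add, EReal.exp_neg, EReal.exp_add, ENNReal.mul_inv]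
  · rw [expNeg, expNeg, EReal.exp_neg, EReal.exp_neg]
  · exact Or.inl (by simp)
  · exact Or.inr (by simp)

lemma expNeg_sum {ι : Type*} (s : Finset ι) (f : ι → ℝ≥0∞) :
    expNeg (∑ i ∈ s, f i) = ∏ i ∈ s, expNeg (f i) := by
  classical
  induction s using Finset.induction_on with
  | empty => simp [expNeg_zero]
  | insert a s ha ih => rw [Finset.sum_insert ha, Finset.prod_insert ha, expNeg_add, ih]

lemma expNeg_mul_natCast (c : ℝ≥0∞) (n : ℕ) : expNeg (c * n) = expNeg c ^ n := by
  have := expNeg_sum (Finset.range n) (fun _ => c)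
  simpa [mul_comm] using this

lemma expNeg_ofReal {a : ℝ} (ha : 0 ≤ a) :
    expNeg (ENNReal.ofReal a) = ENNReal.ofReal (Real.exp (-a)) := by
  rw [expNeg, EReal.coe_ennreal_ofReal, max_eq_left ha, ← EReal.coe_neg, EReal.exp_coe]

lemma expNeg_antitone : Antitone expNeg := fun a b hab => by
  refine EReal.exp_monotone ?_
  simpa using hab

lemma expNeg_le_one (a : ℝ≥0∞) : expNeg a ≤ 1 := by
  rw [← expNeg_zero]
  exact expNeg_antitone zero_le

lemma expNeg_ne_top (a : ℝ≥0∞) : expNeg a ≠ ∞ :=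
  ((expNeg_le_one a).trans_lt ENNReal.one_lt_top).ne

lemma continuous_expNeg : Continuous expNeg :=
  ENNReal.continuous_exp.comp (continuous_neg.comp continuous_coe_ennreal_ereal)

@[fun_prop]
lemma measurable_expNeg : Measurable expNeg := continuous_expNeg.measurable

lemma expNeg_toReal {a : ℝ≥0∞} (ha : a ≠ ∞) :
    (expNeg a).toReal = Real.exp (-a.toReal) := by
  conv_lhs => rw [← ENNReal.ofReal_toReal ha]
  rw [expNeg_ofReal ENNReal.toReal_nonneg, ENNReal.toReal_ofReal (Real.exp_pos _).le]

/-- A version of `lintegral_prod_eq_prod_lintegral_of_indepFun` for a.e.-measurable variables. -/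
lemma lintegral_prod_of_iIndepFun {Ω ι : Type*} [MeasurableSpace Ω] {Pr : Measure Ω}
    (s : Finset ι) (X : ι → Ω → ℝ≥0∞) (hX : iIndepFun X Pr) (hm : ∀ i, AEMeasurable (X i) Pr) :
    ∫⁻ ω, ∏ i ∈ s, X i ω ∂Pr = ∏ i ∈ s, ∫⁻ ω, X i ω ∂Pr := by
  have hX' : iIndepFun (fun i => (hm i).mk) Pr :=
    (iIndepFun_congr fun i => (hm i).ae_eq_mk).1 hX
  calc ∫⁻ ω, ∏ i ∈ s, X i ω ∂Pr = ∫⁻ ω, ∏ i ∈ s, (hm i).mk (X i) ω ∂Pr := by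
        refine lintegral_congr_ae ?_
        have : ∀ᵐ ω ∂Pr, ∀ i ∈ s, X i ω = (hm i).mk (X i) ω :=
          (ae_ball_iff s.finite_toSet.countable).2 fun i _ => (hm i).ae_eq_mk
        filter_upwards [this] with ω hω using Finset.prod_congr rfl hω
    _ = ∏ i ∈ s, ∫⁻ ω, (hm i).mk (X i) ω ∂Pr :=
        lintegral_prod_eq_prod_lintegral_of_indepFun s _ hX' fun i => (hm i).measurable_mk
    _ = _ := Finset.prod_congr rfl fun i _ => (lintegral_congr_ae (hm i).ae_eq_mk).symm

/-! ### The Laplace functional of a Poisson process -/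

/-- The Laplace transform of the Poisson distribution. -/
lemma lintegral_expNeg_poissonMeasure (r : ℝ≥0) (c : ℝ≥0∞) :
    ∫⁻ n : ℕ, expNeg (c * n) ∂(poissonMeasure r) = expNeg ((1 - expNeg c) * r) := by
  -- Working with z = e^{-c} in [0, 1] includes c = ∞ as z = 0, and leaves the exponential series at
  -- r z.
  obtain ⟨z, hz⟩ : ∃ z : ℝ≥0, (z : ℝ≥0∞) = expNeg c :=
    ⟨_, ENNReal.coe_toNNReal (expNeg_ne_top c)⟩
  have hz1 : z ≤ 1 := by exact_mod_cast hz ▸ expNeg_le_one c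
  have hR : (1 - expNeg c) * r = ENNReal.ofReal ((1 - z) * r) := by
    rw [← hz, ENNReal.ofReal_mul (sub_nonneg.2 (by exact_mod_cast hz1)),
      ENNReal.ofReal_sub _ z.coe_nonneg]
    simp
  rw [hR, expNeg_ofReal (mul_nonneg (sub_nonneg.2 (by exact_mod_cast hz1)) r.coe_nonneg), poissonMeasure,
    lintegral_sum_measure]
  simp_rw [lintegral_smul_measure, lintegral_dirac, expNeg_mul_natCast, ← hz]
  have hterm : ∀ n : ℕ, ENNReal.ofReal (Real.exp (-r) * r ^ n / (n.factorial : ℝ)) •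
      ((z : ℝ≥0∞) ^ n) =
      ENNReal.ofReal (Real.exp (-r) * ((r * z : ℝ) ^ n / (n.factorial : ℝ))) := by
    intro n
    rw [smul_eq_mul, ← ENNReal.ofReal_coe_nnreal, ← ENNReal.ofReal_pow z.coe_nonneg,
      ← ENNReal.ofReal_mul (by positivity)]
    congr 1
    rw [mul_pow]
    ring
  simp_rw [hterm]
  have hs : HasSum (fun n : ℕ => Real.exp (-r) * ((r * z : ℝ) ^ n / (n.factorial : ℝ)))
      (Real.exp (-r) * Real.exp (r * z)) := by
    refine HasSum.mul_left _ ?_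
    rw [Real.exp_eq_exp_ℝ]
    exact NormedSpace.expSeries_div_hasSum_exp (r * z : ℝ)
  rw [← ENNReal.ofReal_tsum_of_nonneg (fun n => by positivity) hs.summable, hs.tsum_eq,
    ← Real.exp_add]
  congr 2
  ring

section Poisson

variable {Ω E : Type*} [MeasurableSpace Ω] [MeasurableSpace E] {Pr : Measure Ω}
  {N : Ω → Measure E} {μ : Measure E}

lemma IsPoissonProcess.lintegral_expNeg_mul_count (h : IsPoissonProcess Pr N μ) {A : Set E}
    (hA : MeasurableSet A) (hμ : μ A ≠ ∞) (c : ℝ≥0∞) :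
    ∫⁻ ω, expNeg (c * N ω A) ∂Pr = expNeg ((1 - expNeg c) * μ A) := by
  have hl := h.hasLaw_count A hA hμ
  have hm : Measurable fun a : ℝ≥0∞ => expNeg (c * a) := by fun_prop
  rw [← lintegral_map' (f := fun a => expNeg (c * a)) hm.aemeasurable hl.aemeasurable, hl.map_eq,
    lintegral_map hm measurable_from_nat, lintegral_expNeg_poissonMeasure, ENNReal.coe_toNNReal hμ]

lemma IsPoissonProcess.lintegral_expNeg_sum (h : IsPoissonProcess Pr N μ) {ι : Type*}
    (s : Finset ι) (c : ι → ℝ≥0∞) {A : ι → Set E} (hA : ∀ i, MeasurableSet (A i))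
    (hd : Pairwise (fun i j => Disjoint (A i) (A j))) (hμ : ∀ i, μ (A i) ≠ ∞) :
    ∫⁻ ω, expNeg (∑ i ∈ s, c i * N ω (A i)) ∂Pr =
      expNeg (∑ i ∈ s, (1 - expNeg (c i)) * μ (A i)) := by
  let e := s.equivFin.symm
  have hind := h.indep_count s.card (fun j => A (e j)) (fun j => hA _)
    (fun i j hij => hd fun h' => hij (e.injective (Subtype.ext h')))
  have hind' : iIndepFun (fun j ω => expNeg (c (e j) * N ω (A (e j)))) Pr :=
    hind.comp (fun j a => expNeg (c (e j) * a)) fun j => by fun_prop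
  have hsum : ∀ g : ι → ℝ≥0∞, ∑ i ∈ s, g i = ∑ j, g (e j) := fun g => by
    rw [← Finset.sum_coe_sort s, ← e.sum_comp]
  simp_rw [hsum, expNeg_sum]
  rw [lintegral_prod_of_iIndepFun _ _ hind']
  · exact Finset.prod_congr rfl fun j _ => h.lintegral_expNeg_mul_count (hA _) (hμ _) _
  · intro j
    have := (h.hasLaw_count _ (hA (e j)) (hμ _)).aemeasurable
    exact measurable_expNeg.comp_aemeasurable (this.const_mul _)

/-- Grouping by the values of f, not of g ∘ f, produces the same disjoint level sets for every g, so
the integrals against N and μ can be compared term by term. -/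
lemma setLIntegral_simpleFunc (f : SimpleFunc E ℝ≥0∞) (g : ℝ≥0∞ → ℝ≥0∞) (ν : Measure E)
    (S : Set E) :
    ∫⁻ y in S, g (f y) ∂ν = ∑ a ∈ f.range, g a * ν (f ⁻¹' {a} ∩ S) := by
  have := SimpleFunc.map_lintegral (μ := ν.restrict S) g f
  rw [← SimpleFunc.lintegral_eq_lintegral] at this
  simp only [SimpleFunc.coe_map, Function.comp_apply] at this
  rw [this]
  refine Finset.sum_congr rfl fun a _ => ?_
  rw [Measure.restrict_apply (f.measurableSet_fiber a)]

/-- The Laplace functional of a Poisson point process. -/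
theorem IsPoissonProcess.lintegral_expNeg_lintegral [IsProbabilityMeasure Pr] [SigmaFinite μ]
    (h : IsPoissonProcess Pr N μ) {f : E → ℝ≥0∞} (hf : Measurable f) :
    ∫⁻ ω, expNeg (∫⁻ y, f y ∂N ω) ∂Pr = expNeg (∫⁻ y, (1 - expNeg (f y)) ∂μ) := by
  -- Cutting down to sets of finite intensity is needed because the law of a count is only
  -- prescribed there.
  let S := spanningSets μ
  have hSm : ∀ n, MeasurableSet (S n) := measurableSet_spanningSets μ
  let φ : ℕ → SimpleFunc E ℝ≥0∞ := SimpleFunc.eapprox f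
  have hfin : ∀ n a, μ (φ n ⁻¹' {a} ∩ S n) ≠ ∞ := fun n a =>
    ((measure_mono Set.inter_subset_right).trans_lt (measure_spanningSets_lt_top μ n)).ne
  have hms : ∀ n a, MeasurableSet (φ n ⁻¹' {a} ∩ S n) := fun n a =>
    ((φ n).measurableSet_fiber a).inter (hSm n)
  have hstep : ∀ n, ∫⁻ ω, expNeg (∫⁻ y in S n, φ n y ∂N ω) ∂Pr =
      expNeg (∫⁻ y in S n, (1 - expNeg (φ n y)) ∂μ) := by
    intro n
    simp_rw [setLIntegral_simpleFunc (φ n) (fun a => a),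
      setLIntegral_simpleFunc (φ n) (fun a => 1 - expNeg a)]
    refine h.lintegral_expNeg_sum _ _ (hms n) (fun a b hab => ?_) (hfin n)
    exact (Disjoint.preimage _ (by simpa using hab)).mono Set.inter_subset_left
      Set.inter_subset_left
  -- One monotone convergence argument serves both sides: g = id with the random measure N ω, and
  -- g(a) = 1 - e^{-a} with μ.
  have hconv : ∀ (g : ℝ≥0∞ → ℝ≥0∞) (ν : Measure E), Monotone g → Continuous g → g 0 = 0 →
      Tendsto (fun n => ∫⁻ y in S n, g (φ n y) ∂ν) atTop (𝓝 (∫⁻ y, g (f y) ∂ν)) := by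
    intro g ν hg hgc hg0
    simp_rw [← lintegral_indicator (hSm _)]
    refine lintegral_tendsto_of_tendsto_of_monotone ?_ ?_ ?_
    · intro n
      exact ((hgc.measurable.comp (φ n).measurable).indicator (hSm n)).aemeasurable
    · refine Eventually.of_forall fun y m n hmn => ?_
      refine (Set.indicator_le_indicator_of_subset (monotone_spanningSets μ hmn)
        (fun _ => zero_le) y).trans (Set.indicator_le_indicator ?_)
      exact hg (SimpleFunc.monotone_eapprox f hmn y)
    · refine Eventually.of_forall fun y => ?_
      have h1 : Tendsto (fun n => g (φ n y)) atTop (𝓝 (g (f y))) :=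
        (hgc.tendsto _).comp (SimpleFunc.tendsto_eapprox hf y)
      refine h1.congr' ?_
      filter_upwards [eventually_ge_atTop (spanningSetsIndex μ y)] with n hn
      rw [Set.indicator_of_mem]
      exact monotone_spanningSets μ hn (mem_spanningSetsIndex μ y)
  have hL : Tendsto (fun n => ∫⁻ ω, expNeg (∫⁻ y in S n, φ n y ∂N ω) ∂Pr) atTop
      (𝓝 (∫⁻ ω, expNeg (∫⁻ y, f y ∂N ω) ∂Pr)) := by
    refine tendsto_lintegral_of_dominated_convergence' (fun _ => 1) ?_ ?_ (by simp) ?_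
    · intro n
      simp_rw [setLIntegral_simpleFunc (φ n) (fun a => a)]
      refine measurable_expNeg.comp_aemeasurable
        (Finset.aemeasurable_fun_sum _ fun a _ => AEMeasurable.const_mul ?_ a)
      exact (h.hasLaw_count _ (hms n a) (hfin n a)).aemeasurable
    · exact fun n => Eventually.of_forall fun ω => expNeg_le_one _
    · refine Eventually.of_forall fun ω => (continuous_expNeg.tendsto _).comp ?_
      exact hconv (fun a => a) (N ω) monotone_id continuous_id rfl
  have hR : Tendsto (fun n => expNeg (∫⁻ y in S n, (1 - expNeg (φ n y)) ∂μ)) atTop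
      (𝓝 (expNeg (∫⁻ y, (1 - expNeg (f y)) ∂μ))) := by
    refine (continuous_expNeg.tendsto _).comp (hconv (fun a => 1 - expNeg a) μ ?_ ?_ ?_)
    · exact fun a b hab => tsub_le_tsub_left (expNeg_antitone hab) _
    · exact (ENNReal.continuous_sub_left ENNReal.one_ne_top).comp continuous_expNeg
    · simp [expNeg_zero]
  exact tendsto_nhds_unique (hL.congr hstep) hR

end Poisson

/-! ### Polar coordinates and the Gamma transform -/

/-- Integration of a radial function over the plane in polar coordinates. -/
lemma lintegral_fun_norm_plane {f : ℝ → ℝ≥0∞} (hf : Measurable f) :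
    ∫⁻ x : Plane, f ‖x‖ =
      ENNReal.ofReal (2 * Real.pi) * ∫⁻ r in Set.Ioi (0 : ℝ), ENNReal.ofReal r * f r := by
  have hdim : Module.finrank ℝ Plane = 2 := by simp
  have hprod := (volume : Measure Plane).measurePreserving_homeomorphUnitSphereProd
  rw [hdim] at hprod
  calc ∫⁻ x : Plane, f ‖x‖ = ∫⁻ x in ({0}ᶜ : Set Plane), f ‖x‖ := by
        rw [restrict_compl_singleton]
    _ = ∫⁻ x : ({0}ᶜ : Set Plane), f ‖x.1‖ ∂(volume.comap Subtype.val) :=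
        (lintegral_subtype_comap (measurableSet_singleton _).compl fun x => f ‖x‖).symm
    _ = ∫⁻ z, f z.2 ∂((volume : Measure Plane).toSphere.prod (.volumeIoiPow (2 - 1))) := by
        rw [← hprod.lintegral_comp (f := fun z => f z.2) (by fun_prop)]
        simp
    _ = (volume : Measure Plane).toSphere Set.univ *
          ∫⁻ r : Set.Ioi (0 : ℝ), f r ∂(.volumeIoiPow (2 - 1)) := by
        rw [lintegral_prod _ (by fun_prop)]
        simp only [lintegral_const]
        rw [mul_comm]
    _ = _ := by
        congr 1
        -- The unit circle has mass dimension times area of the unit disc, that is 2 · π.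
        · rw [Measure.toSphere_apply_univ, hdim, EuclideanSpace.volume_ball_fin_two,
            ENNReal.ofReal_mul zero_le_two]
          simp
        · rw [Measure.volumeIoiPow, lintegral_withDensity_eq_lintegral_mul _ (by fun_prop)
            (by fun_prop),
            ← lintegral_subtype_comap measurableSet_Ioi fun r => ENNReal.ofReal r * f r]
          simp

/-- The Laplace transform of the Gamma distribution. -/
lemma lintegral_expNeg_gammaMeasure {a r t : ℝ} (ha : 0 < a) (hr : 0 < r) (ht : 0 ≤ t) :
    ∫⁻ x, expNeg (ENNReal.ofReal (t * x)) ∂(gammaMeasure a r) =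
      ENNReal.ofReal ((1 + t / r) ^ (-a)) := by
  have hrt : 0 < r + t := by linarith
  -- Exponential tilting: multiplying by e^{-t x} turns the density of rate r into that of rate r +
  -- t, up to the normalising constant, which is the transform sought.
  have hpt : ∀ x, gammaPDF a r x * expNeg (ENNReal.ofReal (t * x)) =
      ENNReal.ofReal ((1 + t / r) ^ (-a)) * gammaPDF a (r + t) x := by
    intro x
    rcases lt_or_ge x 0 with hx | hx
    · simp [gammaPDF_of_neg hx]
    have hG := Real.Gamma_pos_of_pos ha
    rw [gammaPDF_of_nonneg hx, gammaPDF_of_nonneg hx, expNeg_ofReal (mul_nonneg ht hx),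
      ← ENNReal.ofReal_mul (by positivity), ← ENNReal.ofReal_mul (by positivity)]
    congr 1
    have h1 : 1 + t / r = (r + t) / r := by field_simp
    rw [h1, Real.rpow_neg (by positivity), Real.div_rpow hrt.le hr.le]
    have := (Real.rpow_pos_of_pos hr a).ne'
    have := (Real.rpow_pos_of_pos hrt a).ne'
    have hexp : Real.exp (-((r + t) * x)) = Real.exp (-(r * x)) * Real.exp (-(t * x)) := by
      rw [← Real.exp_add]
      congr 1
      ring
    rw [hexp]
    field_simp
  rw [gammaMeasure, lintegral_withDensity_eq_lintegral_mul _ (by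
    unfold gammaPDF; fun_prop) (by fun_prop)]
  simp only [Pi.mul_apply, hpt]
  rw [lintegral_const_mul _ (by unfold gammaPDF; fun_prop), lintegral_gammaPDF_eq_one ha hrt,
    mul_one]

/-! ### Integrating out independent marks -/

section Independence

variable {Ω : Type*} [MeasurableSpace Ω] {Pr : Measure Ω}

/-- Induction on n: the n-th pair and all earlier pairs are functions of disjoint finite sets of the
independent variables, so the last factor splits off. -/
lemma lintegral_prod_pairs_of_iIndepFun {M : ℕ ⊕ ℕ → Ω → ℝ} (hM : iIndepFun M Pr)
    (hm : ∀ j, AEMeasurable (M j) Pr) {φ : ℕ → ℝ × ℝ → ℝ≥0∞} (hφ : ∀ i, Measurable (φ i)) (n : ℕ) :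
    ∫⁻ ω, ∏ i ∈ Finset.range n, φ i (M (.inl i) ω, M (.inr i) ω) ∂Pr =
      ∏ i ∈ Finset.range n, ∫⁻ ω, φ i (M (.inl i) ω, M (.inr i) ω) ∂Pr := by
  have := hM.isProbabilityMeasure
  induction n with
  | zero => simp
  | succ n ih =>
    let S : Finset (ℕ ⊕ ℕ) := (Finset.range n).disjSum (Finset.range n)
    let T : Finset (ℕ ⊕ ℕ) := Finset.disjSum {n} {n}
    have hST : Disjoint S T := by
      rw [Finset.disjoint_left]
      rintro (j | j) <;> simp +contextual [S, T, ne_of_lt]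
    have hS1 : ∀ i : Finset.range n, Sum.inl (i : ℕ) ∈ S := fun i =>
      Finset.inl_mem_disjSum.2 i.2
    have hS2 : ∀ i : Finset.range n, Sum.inr (i : ℕ) ∈ S := fun i =>
      Finset.inr_mem_disjSum.2 i.2
    have hT1 : Sum.inl n ∈ T := Finset.inl_mem_disjSum.2 (by simp)
    have hT2 : Sum.inr n ∈ T := Finset.inr_mem_disjSum.2 (by simp)
    have hind := (hM.indepFun_finset₀ S T hST hm).comp
      (φ := fun w : S → ℝ => ∏ i ∈ (Finset.range n).attach, φ i (w ⟨_, hS1 i⟩, w ⟨_, hS2 i⟩))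
      (ψ := fun w : T → ℝ => φ n (w ⟨_, hT1⟩, w ⟨_, hT2⟩))
      (by fun_prop) (by fun_prop)
    have hpair : ∀ i, AEMeasurable (fun ω => φ i (M (.inl i) ω, M (.inr i) ω)) Pr := fun i =>
      (hφ i).comp_aemeasurable ((hm _).prodMk (hm _))
    simp_rw [Finset.prod_range_succ]
    rw [lintegral_mul_eq_lintegral_mul_lintegral_of_indepFun''
      (Finset.aemeasurable_fun_prod _ fun i _ => hpair i) (hpair n), ih]
    convert! hind using 1
    ext ω
    simp only [Function.comp_apply]
    exact (Finset.prod_attach (Finset.range n)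
      fun i => φ i (M (.inl i) ω, M (.inr i) ω)).symm

/-- Independent marks attached to random points may be integrated out point by point. -/
lemma lintegral_prod_marks {𝓨 : Type*} [MeasurableSpace 𝓨] {Y : Ω → ℕ → 𝓨}
    {M : ℕ ⊕ ℕ → Ω → ℝ} (hY : Measurable Y) (hM : iIndepFun M Pr)
    (hm : ∀ j, AEMeasurable (M j) Pr) (hYM : IndepFun Y (fun ω j => M j ω) Pr)
    {φ : 𝓨 × ℝ × ℝ → ℝ≥0∞} (hφ : Measurable φ) {ψ : 𝓨 → ℝ≥0∞}
    (hψ : ∀ y i, ∫⁻ ω, φ (y, M (.inl i) ω, M (.inr i) ω) ∂Pr = ψ y) (n : ℕ) :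
    ∫⁻ ω, ∏ i ∈ Finset.range n, φ (Y ω i, M (.inl i) ω, M (.inr i) ω) ∂Pr =
      ∫⁻ ω, ∏ i ∈ Finset.range n, ψ (Y ω i) ∂Pr := by
  have := hM.isProbabilityMeasure
  have hMm : AEMeasurable (fun ω j => M j ω) Pr := aemeasurable_pi_iff.2 hm
  let F : (ℕ → 𝓨) × (ℕ ⊕ ℕ → ℝ) → ℝ≥0∞ := fun z =>
    ∏ i ∈ Finset.range n, φ (z.1 i, z.2 (.inl i), z.2 (.inr i))
  have hF : Measurable F := by fun_prop
  -- By independence the joint law is a product, so Fubini allows the marks to be averaged with the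
  -- points y frozen.
  have hinner : ∀ y : ℕ → 𝓨, ∫⁻ w, F (y, w) ∂(Pr.map fun ω j => M j ω) =
      ∏ i ∈ Finset.range n, ψ (y i) := by
    intro y
    rw [lintegral_map' (by fun_prop) hMm]
    simp only [F]
    rw [lintegral_prod_pairs_of_iIndepFun hM hm (φ := fun i u => φ (y i, u)) (by fun_prop)]
    exact Finset.prod_congr rfl fun i _ => hψ _ i
  -- Measurability is not assumed of ψ; that of the product comes from its being a partial integral
  -- of F.
  have hψm : Measurable fun y : ℕ → 𝓨 => ∏ i ∈ Finset.range n, ψ (y i) := by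
    simp_rw [← hinner]
    exact hF.lintegral_prod_right'
  calc _ = ∫⁻ ω, F (Y ω, fun j => M j ω) ∂Pr := rfl
    _ = ∫⁻ z, F z ∂((Pr.map Y).prod (Pr.map fun ω j => M j ω)) := by
        rw [← (indepFun_iff_map_prod_eq_prod_map_map hY.aemeasurable hMm).1 hYM,
          lintegral_map' hF.aemeasurable (hY.aemeasurable.prodMk hMm)]
    _ = ∫⁻ y, ∏ i ∈ Finset.range n, ψ (y i) ∂(Pr.map Y) := by
        rw [lintegral_prod _ hF.aemeasurable]
        simp_rw [hinner]
    _ = _ := lintegral_map hψm hY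

end Independence

/-! ### The transform of a single received power -/

namespace Params

variable (p : Params)

lemma pLOS_pos (r : ℝ) : 0 < p.pLOS r := by
  have := p.a_nonneg
  unfold pLOS
  positivity

lemma pLOS_le_one (r : ℝ) : p.pLOS r ≤ 1 := by
  have h : 0 ≤ p.a * Real.exp (-p.b * (180 / Real.pi * Real.arctan |p.h / r| - p.a)) :=
    mul_nonneg p.a_nonneg (Real.exp_pos _).le
  unfold pLOS
  rw [div_le_one (by linarith)]
  linarith

lemma linkProb_nonneg (k : Link) (r : ℝ) : 0 ≤ p.linkProb k r := by
  cases k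
  · exact (p.pLOS_pos r).le
  · exact sub_nonneg.2 (p.pLOS_le_one r)

lemma linkProb_le_one (k : Link) (r : ℝ) : p.linkProb k r ≤ 1 := by
  cases k
  · exact p.pLOS_le_one r
  · exact sub_le_self _ (p.pLOS_pos r).le

@[fun_prop]
lemma measurable_linkProb (k : Link) : Measurable (p.linkProb k) := by
  have h : Measurable p.pLOS := by
    unfold pLOS
    fun_prop
  cases k
  · exact h
  · exact measurable_const.sub h

lemma cd_mem : p.cd ∈ Set.Icc (0 : ℝ) 1 := by
  have := p.θd_mem
  exact ⟨div_nonneg this.1 (by positivity), (div_le_one (by positivity)).2 this.2⟩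

lemma cu_mem : p.cu ∈ Set.Icc (0 : ℝ) 1 := by
  have := p.θu_mem
  exact ⟨div_nonneg this.1 (by positivity), (div_le_one (by positivity)).2 this.2⟩

lemma gainProb_nonneg (ε : Fin 4) : 0 ≤ p.gainProb ε := by
  have hd0 := p.cd_mem.1
  have hu0 := p.cu_mem.1
  have hd1 := sub_nonneg.2 p.cd_mem.2
  have hu1 := sub_nonneg.2 p.cu_mem.2
  fin_cases ε <;> simp only [gainProb] <;> simp <;> positivity

lemma sum_gainProb : ∑ ε, p.gainProb ε = 1 := by
  simp only [gainProb, Fin.sum_univ_four]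
  simp
  ring

lemma gain_nonneg (ε : Fin 4) : 0 ≤ p.gain ε := by
  have := p.GdM_nonneg
  have := p.Gdm_nonneg
  have := p.GuM_nonneg
  have := p.Gum_nonneg
  fin_cases ε <;> simp only [gain] <;> simp <;> positivity

lemma pathPower_nonneg (k : Link) (r : ℝ) : 0 ≤ p.pathPower k r := by
  have := p.P_pos
  unfold pathPower
  positivity

@[fun_prop]
lemma measurable_pathPower (k : Link) : Measurable (p.pathPower k) := by
  unfold pathPower
  fun_prop

lemma lambdaDC_pos : 0 < p.lambdaDC := by
  have := p.R_pos
  have := p.tDC_pos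
  have := p.Ts_pos
  unfold lambdaDC
  positivity

lemma lambdaUC_pos : 0 < p.lambdaUC := by
  have := p.R_pos
  unfold lambdaUC
  positivity

instance sigmaFinite_intensity (lam ρ : ℝ) (q : ℝ → ℝ) : SigmaFinite (intensity lam ρ q) := by
  unfold intensity
  exact SigmaFinite.withDensity_ofReal _

/-- The Laplace transform at `s` of the power received from one interferer with gain `G_ε`, at
ground distance `r` and in link state `k`. -/
def fadingTransform (k : Link) (s : ℝ) (ε : Fin 4) (r : ℝ) : ℝ :=
  (1 + s * (p.gain ε * p.pathPower k r) / p.m k) ^ (-p.m k)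

variable {p} {k : Link} {s : ℝ}

lemma one_le_fadingBase (hs : 0 ≤ s) (ε : Fin 4) (r : ℝ) :
    1 ≤ 1 + s * (p.gain ε * p.pathPower k r) / p.m k := by
  have := p.gain_nonneg ε
  have := p.pathPower_nonneg k r
  have := p.m_pos k
  have : 0 ≤ s * (p.gain ε * p.pathPower k r) / p.m k := by positivity
  linarith

lemma fadingTransform_pos (hs : 0 ≤ s) (ε : Fin 4) (r : ℝ) : 0 < p.fadingTransform k s ε r :=
  Real.rpow_pos_of_pos (by linarith [one_le_fadingBase (p := p) (k := k) hs ε r]) _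

lemma fadingTransform_le_one (hs : 0 ≤ s) (ε : Fin 4) (r : ℝ) :
    p.fadingTransform k s ε r ≤ 1 :=
  Real.rpow_le_one_of_one_le_of_nonpos (one_le_fadingBase hs ε r)
    (neg_nonpos.2 (p.m_pos k).le)

/-- Bernoulli's inequality for the Laplace transform of the fading. -/
lemma one_sub_fadingTransform_le (hs : 0 ≤ s) (ε : Fin 4) (r : ℝ) :
    1 - p.fadingTransform k s ε r ≤ s * (p.gain ε * p.pathPower k r) := by
  have hm := p.m_pos k
  set t := s * (p.gain ε * p.pathPower k r) with ht
  have hb := one_le_fadingBase (p := p) (k := k) hs ε r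
  rw [← ht] at hb
  -- From log(1 + u) ≤ u at u = t/m one gets (1 + t/m)^{-m} ≥ e^{-t}; the claim then follows from 1
  -- - e^{-t} ≤ t.
  have h1 : Real.exp (-t) ≤ p.fadingTransform k s ε r := by
    unfold fadingTransform
    rw [← ht, Real.rpow_def_of_pos (by linarith)]
    refine Real.exp_le_exp.2 ?_
    have h2 : Real.log (1 + t / p.m k) ≤ t / p.m k := by
      linarith [Real.log_le_sub_one_of_pos (show 0 < 1 + t / p.m k by linarith)]
    have h3 : Real.log (1 + t / p.m k) * p.m k ≤ t := by
      rwa [← le_div_iff₀ hm]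
    linarith
  linarith [Real.add_one_le_exp (-t)]

@[fun_prop]
lemma measurable_fadingTransform (ε : Fin 4) : Measurable (p.fadingTransform k s ε) := by
  unfold fadingTransform
  fun_prop

variable (p k s) in
/-- The Laplace transform at `s` of the power received from one interferer at ground distance `r`
and in link state `k`. -/
def powerTransform (r : ℝ) : ℝ := ∑ ε, p.gainProb ε * p.fadingTransform k s ε r

@[fun_prop]
lemma measurable_powerTransform : Measurable (p.powerTransform k s) := by
  unfold powerTransform
  fun_prop

lemma one_sub_powerTransform (r : ℝ) :
    1 - p.powerTransform k s r = ∑ ε, p.gainProb ε * (1 - p.fadingTransform k s ε r) := by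
  simp_rw [mul_sub, Finset.sum_sub_distrib, mul_one, p.sum_gainProb, powerTransform]

lemma powerTransform_le_one (hs : 0 ≤ s) (r : ℝ) : p.powerTransform k s r ≤ 1 := by
  rw [← sub_nonneg, one_sub_powerTransform]
  exact Finset.sum_nonneg fun ε _ => mul_nonneg (p.gainProb_nonneg ε)
    (sub_nonneg.2 (fadingTransform_le_one hs ε r))

/-- An average of positive numbers whose weights sum to one cannot vanish. Positivity is what allows
this factor to be written as e^{-f} with f = -log finite. -/
lemma powerTransform_pos (hs : 0 ≤ s) (r : ℝ) : 0 < p.powerTransform k s r := by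
  have hnn : ∀ ε ∈ Finset.univ, 0 ≤ p.gainProb ε * p.fadingTransform k s ε r := fun ε _ =>
    mul_nonneg (p.gainProb_nonneg ε) (fadingTransform_pos hs ε r).le
  refine (Finset.sum_nonneg hnn).lt_of_ne fun h0 => ?_
  have h1 := (Finset.sum_eq_zero_iff_of_nonneg hnn).1 h0.symm
  have h2 : ∑ ε, p.gainProb ε = 0 := Finset.sum_eq_zero fun ε hε =>
    (mul_eq_zero.1 (h1 ε hε)).resolve_right (fadingTransform_pos hs ε r).ne'
  rw [p.sum_gainProb] at h2
  exact one_ne_zero h2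

end Params

variable {p : Params} {k : Link} {s : ℝ}

lemma kernel_eq (ε : Fin 4) (r : ℝ) :
    kernel p k s ε r = p.linkProb k r * (1 - p.fadingTransform k s ε r) * r := by
  have : s * (p.gain ε * p.pathPower k r) =
      s * p.P * p.gain ε * (r ^ 2 + p.h ^ 2) ^ (-p.α k / 2) := by
    unfold Params.pathPower
    ring
  rw [kernel, Params.fadingTransform, this]

lemma measurable_kernel (ε : Fin 4) : Measurable (kernel p k s ε) := by
  have : kernel p k s ε = fun r => p.linkProb k r * (1 - p.fadingTransform k s ε r) * r :=
    funext (kernel_eq ε)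
  rw [this]
  fun_prop

lemma kernel_nonneg (hs : 0 ≤ s) (ε : Fin 4) {r : ℝ} (hr : 0 ≤ r) : 0 ≤ kernel p k s ε r := by
  rw [kernel_eq]
  exact mul_nonneg (mul_nonneg (p.linkProb_nonneg k r)
    (sub_nonneg.2 (Params.fadingTransform_le_one hs ε r))) hr

/-- The mean of the Laplace transform of one received power over its fading and antenna gains. -/
lemma lintegral_expNeg_marks {Ω : Type*} [MeasurableSpace Ω] {Pr : Measure Ω}
    [IsProbabilityMeasure Pr] {X Y : Ω → ℝ} (hX : HasLaw X (gammaMeasure (p.m k) (p.m k)) Pr)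
    (hY : HasLaw Y p.gainLaw Pr) (hXY : IndepFun X Y Pr) (hs : 0 ≤ s) (r : ℝ) :
    ∫⁻ ω, expNeg (ENNReal.ofReal s * ENNReal.ofReal (X ω * Y ω * p.pathPower k r)) ∂Pr =
      ENNReal.ofReal (p.powerTransform k s r) := by
  have hm := p.m_pos k
  have hf : Measurable fun z : ℝ × ℝ =>
      expNeg (ENNReal.ofReal s * ENNReal.ofReal (z.1 * z.2 * p.pathPower k r)) := by fun_prop
  have : IsProbabilityMeasure p.gainLaw := hY.map_eq ▸ Measure.isProbabilityMeasure_map hY.aemeasurable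
  have := isProbabilityMeasure_gammaMeasure hm hm
  -- The fading is integrated first, with the antenna gain fixed; the outer integral is then a
  -- finite sum over the atoms of `gainLaw`.
  rw [← lintegral_map' (f := fun z : ℝ × ℝ =>
      expNeg (ENNReal.ofReal s * ENNReal.ofReal (z.1 * z.2 * p.pathPower k r)))
    hf.aemeasurable (hX.aemeasurable.prodMk hY.aemeasurable),
    (indepFun_iff_map_prod_eq_prod_map_map hX.aemeasurable hY.aemeasurable).1 hXY, hX.map_eq,
    hY.map_eq, lintegral_prod_symm _ hf.aemeasurable, Params.gainLaw, lintegral_finsetSum_measure,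
    Params.powerTransform, ENNReal.ofReal_sum_of_nonneg fun ε _ =>
      mul_nonneg (p.gainProb_nonneg ε) (Params.fadingTransform_pos hs ε r).le]
  refine Finset.sum_congr rfl fun ε _ => ?_
  rw [lintegral_smul_measure, lintegral_dirac, smul_eq_mul,
    ENNReal.ofReal_mul (p.gainProb_nonneg ε), Params.fadingTransform,
    ← lintegral_expNeg_gammaMeasure hm hm
      (mul_nonneg hs (mul_nonneg (p.gain_nonneg ε) (p.pathPower_nonneg k r)))]
  congr 2
  ext x
  rw [← ENNReal.ofReal_mul hs]
  congr 2
  ring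

/-- The exponent of the Laplace transform of the interference, as an integral over the plane. -/
lemma lintegral_intensity_powerTransform {lam ρ : ℝ} (hlam : 0 ≤ lam) (hρ : 0 ≤ ρ) (hs : 0 ≤ s) :
    ∫⁻ x, ENNReal.ofReal (1 - p.powerTransform k s ‖x‖)
        ∂(Params.intensity lam ρ (p.linkProb k)) =
      ENNReal.ofReal (2 * Real.pi * lam) * ∑ ε : Fin 4, ENNReal.ofReal (p.gainProb ε) *
        ∫⁻ r in Set.Ioi ρ, ENNReal.ofReal (kernel p k s ε r) := by
  let g : ℝ → ℝ≥0∞ := fun r =>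
    ENNReal.ofReal (lam * p.linkProb k r) * ENNReal.ofReal (1 - p.powerTransform k s r)
  have hg : Measurable g := by fun_prop
  rw [Params.intensity, lintegral_withDensity_eq_lintegral_mul _ (by fun_prop) (by fun_prop),
    ← lintegral_indicator Metric.isClosed_closedBall.measurableSet.compl]
  calc _ = ∫⁻ x : Plane, (Set.Ioi ρ).indicator g ‖x‖ := by
        refine lintegral_congr fun x => ?_
        by_cases hx : ρ < ‖x‖ <;> simp [Set.indicator, hx, g]
    _ = ENNReal.ofReal (2 * Real.pi) * ∫⁻ r in Set.Ioi ρ, ENNReal.ofReal r * g r := by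
        rw [lintegral_fun_norm_plane (hg.indicator measurableSet_Ioi)]
        congr 1
        rw [← lintegral_indicator measurableSet_Ioi, ← lintegral_indicator measurableSet_Ioi]
        refine lintegral_congr fun r => ?_
        by_cases hr : ρ < r
        · simp [Set.indicator, hr, hρ.trans_lt hr]
        · simp [Set.indicator, hr]
    _ = ENNReal.ofReal (2 * Real.pi) * ∫⁻ r in Set.Ioi ρ, ENNReal.ofReal lam *
          ∑ ε : Fin 4, ENNReal.ofReal (p.gainProb ε) * ENNReal.ofReal (kernel p k s ε r) := by
        congr 1
        refine setLIntegral_congr_fun measurableSet_Ioi fun r hr => ?_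
        have hr0 : 0 ≤ r := hρ.trans (le_of_lt hr)
        have hq := p.linkProb_nonneg k r
        simp only [g]
        simp_rw [← ENNReal.ofReal_mul (p.gainProb_nonneg _)]
        rw [← ENNReal.ofReal_sum_of_nonneg fun ε _ =>
            mul_nonneg (p.gainProb_nonneg ε) (kernel_nonneg hs ε hr0),
          ← ENNReal.ofReal_mul hlam, ← ENNReal.ofReal_mul (by positivity),
          ← ENNReal.ofReal_mul hr0, Params.one_sub_powerTransform]
        congr 1
        simp_rw [kernel_eq, Finset.mul_sum]
        refine Finset.sum_congr rfl fun ε _ => ?_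
        ring
    _ = _ := by
        have hk := measurable_kernel (p := p) (k := k) (s := s)
        rw [lintegral_const_mul _ (by fun_prop), lintegral_finsetSum _ (by fun_prop), ← mul_assoc,
          ← ENNReal.ofReal_mul (by positivity)]
        simp_rw [lintegral_const_mul _ (hk _).ennreal_ofReal]

/-! ### The Laplace transform of the interference -/

section Interference

variable {lam ρ : ℝ} {Ω : Type*} [MeasurableSpace Ω] {Pr : Measure Ω}
  {x : ℕ → Ω → Plane} {state : ℕ → Ω → Link} {H : Link → ℕ → Ω → ℝ} {G : ℕ → Ω → ℝ}

lemma IsInterfererField.measurableSet_state (hF : IsInterfererField p lam ρ Pr x state H G)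
    (k : Link) (i : ℕ) : MeasurableSet {ω | state i ω = k} :=
  hF.measurable_state i (show MeasurableSet ({k} : Set Link) from trivial)

lemma IsInterfererField.aemeasurable_term (hF : IsInterfererField p lam ρ Pr x state H G)
    (k : Link) (i : ℕ) :
    AEMeasurable (fun ω => if state i ω = k then
      ENNReal.ofReal (H k i ω * G i ω * p.pathPower k ‖x i ω‖) else 0) Pr := by
  have h1 := (hF.hasLaw_fading k i).aemeasurable
  have h2 := (hF.hasLaw_gain i).aemeasurable
  have h3 : Measurable fun ω => p.pathPower k ‖x i ω‖ :=
    (p.measurable_pathPower k).comp (hF.measurable_x i).norm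
  have h4 : AEMeasurable (fun ω =>
      ENNReal.ofReal (H k i ω * G i ω * p.pathPower k ‖x i ω‖)) Pr :=
    ((h1.mul h2).mul h3.aemeasurable).ennreal_ofReal
  convert h4.indicator (hF.measurableSet_state k i) using 1
  ext ω
  simp [Set.indicator_apply]

lemma IsInterfererField.aemeasurable_interference (hF : IsInterfererField p lam ρ Pr x state H G)
    (k : Link) : AEMeasurable (interference p k x state H G) Pr :=
  AEMeasurable.tsum (hF.aemeasurable_term k)

/-- Averaging the Laplace transform of a partial sum of the interference over all gains. -/
lemma IsInterfererField.lintegral_expNeg_partial [IsProbabilityMeasure Pr]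
    (hF : IsInterfererField p lam ρ Pr x state H G) (k : Link) (hs : 0 ≤ s) (n : ℕ) :
    ∫⁻ ω, expNeg (ENNReal.ofReal s * ∑ i ∈ Finset.range n, if state i ω = k then
        ENNReal.ofReal (H k i ω * G i ω * p.pathPower k ‖x i ω‖) else 0) ∂Pr =
      ∫⁻ ω, expNeg (∑ i ∈ Finset.range n, if state i ω = k then
        ENNReal.ofReal (-Real.log (p.powerTransform k s ‖x i ω‖)) else 0) ∂Pr := by
  let e : ℕ ⊕ ℕ → (Link × ℕ) ⊕ ℕ := Sum.map (fun i => (k, i)) id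
  have he : Function.Injective e :=
    Sum.map_injective.2 ⟨fun i j h => (Prod.ext_iff.1 h).2, Function.injective_id⟩
  let M : ℕ ⊕ ℕ → Ω → ℝ := Sum.elim (H k) G
  have hM : iIndepFun M Pr := by
    convert hF.indep_marks.precomp he using 1
    ext (j | j) ω <;> rfl
  have hm : ∀ j, AEMeasurable (M j) Pr := by
    rintro (j | j)
    · exact (hF.hasLaw_fading k j).aemeasurable
    · exact (hF.hasLaw_gain j).aemeasurable
  let Y : Ω → ℕ → Plane × Link := fun ω i => (x i ω, state i ω)
  have hY : Measurable Y :=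
    measurable_pi_iff.2 fun i => (hF.measurable_x i).prodMk (hF.measurable_state i)
  have hYM : IndepFun Y (fun ω j => M j ω) Pr := by
    have hMe : (fun ω j => M j ω) = fun ω j =>
        Sum.elim (fun j : Link × ℕ => H j.1 j.2 ω) (fun i => G i ω) (e j) := by
      funext ω j
      rcases j with j | j <;> rfl
    rw [hMe]
    exact hF.indep_positions.comp (φ := id)
      (ψ := fun (w : (Link × ℕ) ⊕ ℕ → ℝ) (j : ℕ ⊕ ℕ) => w (e j)) measurable_id (by fun_prop)
  have hset : MeasurableSet {z : (Plane × Link) × ℝ × ℝ | z.1.2 = k} :=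
    (measurable_snd.comp measurable_fst) (show MeasurableSet ({k} : Set Link) from trivial)
  let φ : (Plane × Link) × ℝ × ℝ → ℝ≥0∞ := fun z => expNeg (ENNReal.ofReal s *
    if z.1.2 = k then ENNReal.ofReal (z.2.1 * z.2.2 * p.pathPower k ‖z.1.1‖) else 0)
  have hφ : Measurable φ :=
    measurable_expNeg.comp ((Measurable.ite hset (by fun_prop) measurable_const).const_mul _)
  -- The averaged factor is written as an exponential so that the product becomes a sum over points;
  -- a point in the other state contributes the factor 1.
  let ψ : Plane × Link → ℝ≥0∞ := fun y =>
    expNeg (if y.2 = k then ENNReal.ofReal (-Real.log (p.powerTransform k s ‖y.1‖)) else 0)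
  have hψ : ∀ y i, ∫⁻ ω, φ (y, M (.inl i) ω, M (.inr i) ω) ∂Pr = ψ y := by
    rintro ⟨y, l⟩ i
    by_cases hl : l = k
    · have hpos := Params.powerTransform_pos (p := p) (k := k) hs ‖y‖
      simp only [φ, ψ, hl, if_true]
      rw [expNeg_ofReal (neg_nonneg.2 (Real.log_nonpos hpos.le
        (Params.powerTransform_le_one hs _))), neg_neg, Real.exp_log hpos]
      exact lintegral_expNeg_marks (hF.hasLaw_fading k i) (hF.hasLaw_gain i)
        (hM.indepFun Sum.inl_ne_inr) hs _
    · simp [φ, ψ, hl, expNeg_zero]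
  have key := lintegral_prod_marks hY hM hm hYM hφ hψ n
  simp only [φ, ψ, ← expNeg_sum, ← Finset.mul_sum] at key
  exact key

/-- Both sides of the identity for the first n points converge. The limiting sum of f = -log
`powerTransform` is an integral against the counting measure of Φ_k, so its Laplace functional
applies, and 1 - e^{-f} is 1 - `powerTransform`. -/
theorem IsInterfererField.laplaceTransform_interference [IsProbabilityMeasure Pr]
    (hF : IsInterfererField p lam ρ Pr x state H G) (k : Link) (hlam : 0 ≤ lam) (hρ : 0 ≤ ρ)
    (hs : 0 ≤ s) :
    laplaceTransform Pr (interference p k x state H G) s =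
      expNeg (ENNReal.ofReal (2 * Real.pi * lam) * ∑ ε : Fin 4, ENNReal.ofReal (p.gainProb ε) *
        ∫⁻ r in Set.Ioi ρ, ENNReal.ofReal (kernel p k s ε r)) := by
  let f : Plane → ℝ≥0∞ := fun y => ENNReal.ofReal (-Real.log (p.powerTransform k s ‖y‖))
  have hf : Measurable f := by fun_prop
  have hterm : ∀ i, Measurable fun ω => if state i ω = k then f (x i ω) else 0 := fun i =>
    Measurable.ite (hF.measurableSet_state k i) (hf.comp (hF.measurable_x i)) measurable_const
  have hleft : Tendsto (fun n => ∫⁻ ω, expNeg (ENNReal.ofReal s * ∑ i ∈ Finset.range n,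
      if state i ω = k then ENNReal.ofReal (H k i ω * G i ω * p.pathPower k ‖x i ω‖) else 0) ∂Pr)
      atTop (𝓝 (laplaceTransform Pr (interference p k x state H G) s)) := by
    refine tendsto_lintegral_of_dominated_convergence' (fun _ => 1) (fun n => ?_)
      (fun n => Eventually.of_forall fun ω => expNeg_le_one _) (by simp)
      (Eventually.of_forall fun ω => ?_)
    · exact measurable_expNeg.comp_aemeasurable
        ((Finset.aemeasurable_fun_sum _ fun i _ => hF.aemeasurable_term k i).const_mul _)
    · exact (continuous_expNeg.tendsto _).comp (ENNReal.Tendsto.const_mul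
        (ENNReal.summable.hasSum.tendsto_sum_nat) (Or.inr ENNReal.ofReal_ne_top))
  have hright : Tendsto (fun n => ∫⁻ ω, expNeg (∑ i ∈ Finset.range n,
      if state i ω = k then f (x i ω) else 0) ∂Pr)
      atTop (𝓝 (∫⁻ ω, expNeg (∑' i, if state i ω = k then f (x i ω) else 0) ∂Pr)) := by
    refine tendsto_lintegral_of_dominated_convergence' (fun _ => 1) (fun n => ?_)
      (fun n => Eventually.of_forall fun ω => expNeg_le_one _) (by simp)
      (Eventually.of_forall fun ω => ?_)
    · exact (measurable_expNeg.comp (Finset.measurable_fun_sum _ fun i _ => hterm i)).aemeasurable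
    · exact (continuous_expNeg.tendsto _).comp ENNReal.summable.hasSum.tendsto_sum_nat
  rw [tendsto_nhds_unique hleft
    (hright.congr fun n => (hF.lintegral_expNeg_partial k hs n).symm),
    ← lintegral_intensity_powerTransform hlam hρ hs]
  have hN : ∀ ω, ∑' i, (if state i ω = k then f (x i ω) else 0) =
      ∫⁻ y, f y ∂(Measure.sum fun i => if state i ω = k then Measure.dirac (x i ω) else 0) := by
    intro ω
    rw [lintegral_sum_measure]
    refine tsum_congr fun i => ?_
    split_ifs <;> simp
  simp_rw [hN]
  rw [(hF.poisson_link k).lintegral_expNeg_lintegral hf]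
  congr 1
  refine lintegral_congr fun y => ?_
  have hpos := Params.powerTransform_pos (p := p) (k := k) hs ‖y‖
  rw [expNeg_ofReal (neg_nonneg.2 (Real.log_nonpos hpos.le
    (Params.powerTransform_le_one hs _))), neg_neg, Real.exp_log hpos,
    ENNReal.ofReal_sub _ hpos.le, ENNReal.ofReal_one]

end Interference

/-! ### Finiteness for path loss exponents above two -/

section FiniteInterference

variable {p : Params} {k : Link} {s lam ρ : ℝ}

/-- Dropping h² only increases the negative power, leaving a multiple of r^{1-α}, integrable away
from the origin because 1 - α < -1. -/
lemma Params.integrableOn_meanPower (hα : 2 < p.α k) (hρ : 0 < ρ) (ε : Fin 4) :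
    IntegrableOn (fun r => p.gain ε * p.pathPower k r * r) (Set.Ioi ρ) := by
  have hP := p.P_pos
  have hg := p.gain_nonneg ε
  have hint : IntegrableOn (fun r : ℝ => p.gain ε * p.P * r ^ (1 - p.α k)) (Set.Ioi ρ) :=
    (integrableOn_Ioi_rpow_of_lt (by linarith) hρ).const_mul _
  refine hint.mono' (by fun_prop) ?_
  refine (ae_restrict_iff' measurableSet_Ioi).2 (Eventually.of_forall fun r hr => ?_)
  have hr0 : 0 < r := hρ.trans hr
  have hle : (r ^ 2 + p.h ^ 2) ^ (-p.α k / 2) ≤ r ^ (-p.α k) := by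
    calc (r ^ 2 + p.h ^ 2) ^ (-p.α k / 2) ≤ (r ^ 2) ^ (-p.α k / 2) :=
          Real.rpow_le_rpow_of_nonpos (by positivity) (by linarith [sq_nonneg p.h]) (by linarith)
      _ = r ^ (-p.α k) := by
          rw [← Real.rpow_natCast, ← Real.rpow_mul hr0.le]
          congr 1
          push_cast
          ring
  rw [Real.norm_of_nonneg
    (mul_nonneg (mul_nonneg hg (p.pathPower_nonneg k r)) hr0.le)]
  calc p.gain ε * p.pathPower k r * r
      = p.gain ε * p.P * ((r ^ 2 + p.h ^ 2) ^ (-p.α k / 2) * r) := by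
        unfold Params.pathPower
        ring
    _ ≤ p.gain ε * p.P * (r ^ (-p.α k) * r) := by gcongr
    _ = p.gain ε * p.P * r ^ (1 - p.α k) := by
        rw [sub_eq_neg_add, Real.rpow_add_one hr0.ne']

/-- Linearity of the bound in s matters: it gives integrability for fixed s and also control of the
exponent as s → 0. -/
lemma kernel_le (hs : 0 ≤ s) (ε : Fin 4) {r : ℝ} (hr : 0 ≤ r) :
    kernel p k s ε r ≤ s * (p.gain ε * p.pathPower k r * r) := by
  rw [kernel_eq]
  have h0 := sub_nonneg.2 (Params.fadingTransform_le_one (p := p) (k := k) hs ε r)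
  calc p.linkProb k r * (1 - p.fadingTransform k s ε r) * r
      ≤ 1 * (s * (p.gain ε * p.pathPower k r)) * r := by
        gcongr
        · exact p.linkProb_le_one k r
        · exact Params.one_sub_fadingTransform_le hs ε r
    _ = s * (p.gain ε * p.pathPower k r * r) := by ring

lemma integrableOn_kernel (hα : 2 < p.α k) (hρ : 0 < ρ) (hs : 0 ≤ s) (ε : Fin 4) :
    IntegrableOn (kernel p k s ε) (Set.Ioi ρ) := by
  refine ((Params.integrableOn_meanPower hα hρ ε).const_mul s).mono'
    (measurable_kernel ε).aestronglyMeasurable ?_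
  refine (ae_restrict_iff' measurableSet_Ioi).2 (Eventually.of_forall fun r hr => ?_)
  have hr0 : 0 ≤ r := (hρ.trans hr).le
  rw [Real.norm_of_nonneg (kernel_nonneg hs ε hr0)]
  exact kernel_le hs ε hr0

variable {Ω : Type*} [MeasurableSpace Ω] {Pr : Measure Ω} [IsProbabilityMeasure Pr]

/-- A random variable whose Laplace transform tends to one at zero is almost surely finite. -/
lemma ae_lt_top_of_laplaceTransform_ge {I : Ω → ℝ≥0∞} (hI : AEMeasurable I Pr) {K : ℝ≥0∞}
    (hK : K ≠ ∞) (h : ∀ t : ℝ, 0 < t → expNeg (ENNReal.ofReal t * K) ≤ laplaceTransform Pr I t) :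
    ∀ᵐ ω ∂Pr, I ω < ∞ := by
  have hset : NullMeasurableSet {ω | I ω < ∞} Pr := hI.nullMeasurable measurableSet_Iio
  have hbound : ∀ t : ℝ, 0 < t → expNeg (ENNReal.ofReal t * K) ≤ Pr {ω | I ω < ∞} := by
    intro t ht
    refine (h t ht).trans ?_
    rw [← lintegral_indicator_one₀ hset]
    -- For t > 0, e^{-t I} vanishes where I = ∞, hence lies below the indicator of I < ∞.
    refine lintegral_mono fun ω => ?_
    change expNeg _ ≤ _
    by_cases hω : I ω < ∞
    · rw [Set.indicator_of_mem (by exact hω)]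
      exact expNeg_le_one _
    · rw [not_lt_top_iff.1 hω, ENNReal.mul_top (by simpa using ht), expNeg_top]
      exact zero_le
  have hlim : Tendsto (fun n : ℕ => expNeg (ENNReal.ofReal (1 / ((n : ℝ) + 1)) * K)) atTop
      (𝓝 1) := by
    have h0 := ENNReal.Tendsto.mul_const
      (ENNReal.tendsto_ofReal tendsto_one_div_add_atTop_nhds_zero_nat) (Or.inr hK)
    rw [ENNReal.ofReal_zero, zero_mul] at h0
    simpa [expNeg_zero, Function.comp_def] using (continuous_expNeg.tendsto 0).comp h0
  have h1 : 1 ≤ Pr {ω | I ω < ∞} :=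
    le_of_tendsto hlim (Eventually.of_forall fun n => hbound _ (by positivity))
  exact (prob_compl_eq_zero_iff₀ hset).2 (le_antisymm prob_le_one h1)

variable {x : ℕ → Ω → Plane} {state : ℕ → Ω → Link} {H : Link → ℕ → Ω → ℝ} {G : ℕ → Ω → ℝ}

/-- The constant K is the mean interference that would result if every link were in state k; by
`kernel_le` the exponent at t is at most t K. -/
lemma IsInterfererField.interference_lt_top (hF : IsInterfererField p lam ρ Pr x state H G)
    (hα : 2 < p.α k) (hlam : 0 ≤ lam) (hρ : 0 < ρ) :
    ∀ᵐ ω ∂Pr, interference p k x state H G ω < ∞ := by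
  let D : Fin 4 → ℝ≥0∞ := fun ε =>
    ∫⁻ r in Set.Ioi ρ, ENNReal.ofReal (p.gain ε * p.pathPower k r * r)
  have hD : ∀ ε, D ε ≠ ∞ := fun ε => (Params.integrableOn_meanPower hα hρ ε).lintegral_lt_top.ne
  refine ae_lt_top_of_laplaceTransform_ge (hF.aemeasurable_interference k)
    (K := ENNReal.ofReal (2 * Real.pi * lam) * ∑ ε, ENNReal.ofReal (p.gainProb ε) * D ε)
    (ENNReal.mul_ne_top ENNReal.ofReal_ne_top (ENNReal.sum_ne_top.2 fun ε _ =>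
      ENNReal.mul_ne_top ENNReal.ofReal_ne_top (hD ε))) fun t ht => ?_
  rw [hF.laplaceTransform_interference k hlam hρ.le ht.le]
  refine expNeg_antitone ?_
  rw [mul_left_comm, Finset.mul_sum (a := ENNReal.ofReal t)]
  refine mul_le_mul_right (Finset.sum_le_sum fun ε _ => ?_) _
  rw [mul_left_comm]
  refine mul_le_mul_right ?_ _
  rw [← lintegral_const_mul _ (by fun_prop)]
  refine setLIntegral_mono (by fun_prop) fun r hr => ?_
  rw [← ENNReal.ofReal_mul ht.le]
  exact ENNReal.ofReal_le_ofReal (kernel_le ht.le ε (hρ.trans hr).le)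

theorem IsInterfererField.hasLaplaceForm (hF : IsInterfererField p lam ρ Pr x state H G)
    (k : Link) (hlam : 0 ≤ lam) (hρ : 0 < ρ) (hs : 0 ≤ s) :
    HasLaplaceForm p lam ρ k Pr (interference p k x state H G) s := by
  have hL := hF.laplaceTransform_interference k hlam hρ.le hs
  refine ⟨hL, fun hα => ?_⟩
  have hfin := hF.interference_lt_top hα hlam hρ
  have hker := integrableOn_kernel (p := p) (k := k) hα hρ hs
  refine ⟨hfin, hker, ?_⟩
  have hI := hF.aemeasurable_interference k
  have hleft : ∫ ω, Real.exp (-s * (interference p k x state H G ω).toReal) ∂Pr =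
      (laplaceTransform Pr (interference p k x state H G) s).toReal := by
    rw [integral_eq_lintegral_of_nonneg_ae (Eventually.of_forall fun ω => (Real.exp_pos _).le)
      (Real.measurable_exp.comp_aemeasurable
        (hI.ennreal_toReal.const_mul _)).aestronglyMeasurable]
    congr 1
    refine lintegral_congr_ae ?_
    filter_upwards [hfin] with ω hω
    change _ = expNeg _
    conv_rhs => rw [← ENNReal.ofReal_toReal hω.ne]
    rw [← ENNReal.ofReal_mul hs, expNeg_ofReal (mul_nonneg hs ENNReal.toReal_nonneg), neg_mul]
  have hterm : ∀ ε, ENNReal.ofReal (p.gainProb ε) *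
      ∫⁻ r in Set.Ioi ρ, ENNReal.ofReal (kernel p k s ε r) ≠ ∞ := fun ε =>
    ENNReal.mul_ne_top ENNReal.ofReal_ne_top (hker ε).lintegral_lt_top.ne
  rw [hleft, hL, expNeg_toReal
    (ENNReal.mul_ne_top ENNReal.ofReal_ne_top (ENNReal.sum_ne_top.2 fun ε _ => hterm ε)),
    ENNReal.toReal_mul, ENNReal.toReal_sum fun ε _ => hterm ε,
    ENNReal.toReal_ofReal (by positivity)]
  have hε : ∀ ε, (ENNReal.ofReal (p.gainProb ε) *
      ∫⁻ r in Set.Ioi ρ, ENNReal.ofReal (kernel p k s ε r)).toReal =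
      p.gainProb ε * ∫ r in Set.Ioi ρ, kernel p k s ε r := by
    intro ε
    rw [ENNReal.toReal_mul, ENNReal.toReal_ofReal (p.gainProb_nonneg ε),
      integral_eq_lintegral_of_nonneg_ae
        ((ae_restrict_iff' measurableSet_Ioi).2 (Eventually.of_forall fun r hr =>
          kernel_nonneg hs ε (hρ.trans hr).le)) (hker ε).aestronglyMeasurable]
  simp_rw [hε]
  congr 1
  ring

end FiniteInterference

end UAVUplink

end

theorem lemma1 (p : UAVUplink.Params) {Ω : Type*} [MeasurableSpace Ω] (Pr : Measure Ω)
    [IsProbabilityMeasure Pr] (x : ℕ → Ω → UAVUplink.Plane) (state : ℕ → Ω → UAVUplink.Link)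
    (H : UAVUplink.Link → ℕ → Ω → ℝ) (G : ℕ → Ω → ℝ) (s : ℝ) (hs : 0 ≤ s) :
    (UAVUplink.IsInterfererField p p.lambdaDC (p.R / 2) Pr x state H G →
      ∀ k : UAVUplink.Link, UAVUplink.HasLaplaceForm p p.lambdaDC (p.R / 2) k Pr
        (UAVUplink.interference p k x state H G) s) ∧
    (UAVUplink.IsInterfererField p p.lambdaUC p.R Pr x state H G →
      ∀ k : UAVUplink.Link, UAVUplink.HasLaplaceForm p p.lambdaUC p.R k Pr
        (UAVUplink.interference p k x state H G) s) :=
  ⟨fun hF k => hF.hasLaplaceForm k p.lambdaDC_pos.le (half_pos p.R_pos) hs,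
    fun hF k => hF.hasLaplaceForm k p.lambdaUC_pos.le p.R_pos hs⟩
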